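/- Let $\overline{\mathbb Q}_{\ge 0}=\mathbb Q_{\ge 0}\cup\{\infty\}$, with $c+\infty=\infty+c=\infty$ and $0\cdot\infty=\infty\cdot 0=0$. Let $\tau$ be a finite signature of function symbols $f$ of positive arity $ar(f)$. A (general-)valued $\tau$-structure $A$ on a finite domain $D=D(A)$ assigns to every $f\in\tau$ a function $f^A:D^{ar(f)}\to\overline{\mathbb Q}_{\ge 0}$. An instance of VCSP$(A)$ is a valued $\tau$-structure $I$ with a finite domain $X$. The measure of a solution $h:X\to D$ is $\sum_{f\in\tau,\ \bar x\in X^{ar(f)}} f^I(\bar x)\,f^A(h(\bar x))$, and $\mathrm{opt}_A(I)$ denotes the minimum measure of a solution. The algorithm BLP$_g$ works in two stages on an instance $I$. (1) It computes the largest arc consistent domains $L(x)\subseteq D$ $(x\in X)$, where domains $(L(x))_{x\in X}$ are arc consistent if for all $f\in\tau$, $\bar x\in X^{ar(f)}$, $x\in\{\bar x\}$ and $a\in L(x)$ there is $\sigma:\{\bar x\}\to D$ with $\sigma(x)=a$, $\sigma(y)\in L(y)$ for all $y\in\{\bar x\}$, and $f^I(\bar x)f^A(\sigma(\bar x))<\infty$.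 If some $L(x)$ is empty, it returns $\infty$. (2) Otherwise it returns the optimum of the linear program: minimise $$\sum_{f,\bar x}\ \sum_{\sigma:\{\bar x\}\to D} f^I(\bar x)\,f^A(\sigma(\bar x))\,\lambda_{f,\bar x,\sigma}$$ subject to $\sum_{\sigma:\sigma(x)=a}\lambda_{f,\bar x,\sigma}=\mu_x(a)$ for all $f\in\tau$, $\bar x\in X^{ar(f)}$, $x\in\{\bar x\}$, $a\in D$; $\sum_{a\in D}\mu_x(a)=1$ for all $x\in X$; $0\le\lambda,\mu\le 1$; and $\mu_x(a)=0$ for $a\notin L(x)$. BLP$_g$ *solves* VCSP$(A)$ if for every instance $I$ of VCSP$(A)$ the returned value equals $\mathrm{opt}_A(I)$. Let $b\ne c$ be elements of $D$ and let $(D;<)$ be a partial order that relates all pairs of elements except for $b$ and $c$. Let $g_1,g_2:D^2\to D$ be commutative operations such that * if $\{x,y\}\ne\{b,c\}$, then $g_1(x,y)=x\wedge y$ and $g_2(x,y)=x\vee y$; * if $\{x,y\}=\{b,c\}$, then $\{g_1(x,y),g_2(x,y)\}\cap\{x,y\}=\emptyset$ and $g_1(x,y)<g_2(x,y)$. Assume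 that $\langle g_1,g_2\rangle$ is a multimorphism of $A$ (a *1-defect multimorphism*), that is, $$f^A(g_1(\bar a_1,\bar a_2))+f^A(g_2(\bar a_1,\bar a_2))\le f^A(\bar a_1)+f^A(\bar a_2)$$ for all $f\in\tau$ and $\bar a_1,\bar a_2\in D^{ar(f)}$, where $g_1,g_2$ are applied componentwise. **Then BLP$_g$ solves VCSP$(A)$.** Moreover, $g_1(b,c)<b,c$ or $g_2(b,c)>b,c$. In the first case, for every $m\ge1$, the clone generated by $g_1$ contains a symmetric $m$-ary operation (one that is invariant under all permutations of its arguments). In the second case, the same holds for the clone generated by $g_2$. -/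

import Mathlib

open scoped NNRat NNReal ENNReal

universe u v w

/-- The extended non-negative rationals `ℚ≥0 ∪ {∞}`. In `WithTop ℚ≥0` one has
`c + ⊤ = ⊤ + c = ⊤` and `0 * ⊤ = ⊤ * 0 = 0`. -/
abbrev ExtRat : Type := WithTop ℚ≥0

/-- The inclusion of `ℚ≥0 ∪ {∞}` into `[0, ∞]`. -/
noncomputable def ExtRat.toENNReal (q : ExtRat) : ℝ≥0∞ :=
  WithTop.recTopCoe ⊤ (fun r : ℚ≥0 => ((r : ℝ≥0) : ℝ≥0∞)) q

theorem ExtRat.toENNReal_top : ExtRat.toENNReal ⊤ = ⊤ := rfl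

theorem ExtRat.toENNReal_coe (r : ℚ≥0) :
    ExtRat.toENNReal (r : ExtRat) = ((r : ℝ≥0) : ℝ≥0∞) := rfl

/-- A signature: function symbols with positive arities. -/
structure VSignature where
  Symbol : Type u
  arity : Symbol → ℕ
  arity_pos : ∀ f, 0 < arity f

/-- A general-valued structure over the signature `S` with domain `D`. -/
structure ValuedStructure (S : VSignature.{u}) (D : Type v) where
  val : (f : S.Symbol) → (Fin (S.arity f) → D) → ExtRat

namespace ValuedStructure

variable {S : VSignature.{u}} {D : Type v} {X : Type w}

/-- The cost `f^I(x̄) · f^A(t)` of assigning the tuple `t` to the scope `x̄`. -/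
noncomputable def cost (I : ValuedStructure S X) (A : ValuedStructure S D)
    (f : S.Symbol) (x : Fin (S.arity f) → X) (t : Fin (S.arity f) → D) : ExtRat :=
  I.val f x * A.val f t

/-- The measure of the solution `h` to the instance `I` of `VCSP(A)`. -/
noncomputable def measure [Fintype S.Symbol] [Fintype X] (I : ValuedStructure S X)
    (A : ValuedStructure S D) (h : X → D) : ExtRat :=
  ∑ f : S.Symbol, ∑ x : Fin (S.arity f) → X, cost I A f x (fun i => h (x i))

/-- `opt_A(I)`: the minimum measure of a solution (the infimum is over the finite set of all
solutions when `X` and `D` are finite). -/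
noncomputable def opt [Fintype S.Symbol] [Fintype X] (I : ValuedStructure S X)
    (A : ValuedStructure S D) : ℝ≥0∞ :=
  ⨅ h : X → D, (measure I A h).toENNReal

/-! ### The basic linear programming relaxation -/

/-- A local assignment `σ : {x̄} → D` on the set of elements of the tuple `x̄`. -/
abbrev LocalAssignment {k : ℕ} (x : Fin k → X) (D : Type v) : Type (max v w) :=
  Set.range x → D

/-- The tuple `σ(x̄)`. -/
def LocalAssignment.tuple {k : ℕ} {x : Fin k → X} (σ : LocalAssignment x D) : Fin k → D :=
  fun i => σ ⟨x i, i, rfl⟩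

/-- An assignment of real values to the variables `λ_{f,x̄,σ}` and `μ_x(a)` of the linear
program. -/
structure LPPoint (S : VSignature.{u}) (X : Type w) (D : Type v) where
  lam : (f : S.Symbol) → (x : Fin (S.arity f) → X) → LocalAssignment x D → ℝ
  mu : X → D → ℝ

open Classical in
/-- The constraints of the basic linear programming relaxation. -/
structure LPPoint.IsFeasible [Fintype X] [Fintype D] (p : LPPoint S X D) : Prop where
  marginal : ∀ (f : S.Symbol) (x : Fin (S.arity f) → X) (y : Set.range x) (a : D),
    ∑ σ : LocalAssignment x D with σ y = a, p.lam f x σ = p.mu y a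
  total : ∀ x : X, ∑ a : D, p.mu x a = 1
  lam_mem : ∀ (f : S.Symbol) (x : Fin (S.arity f) → X) (σ : LocalAssignment x D),
    p.lam f x σ ∈ Set.Icc (0 : ℝ) 1
  mu_mem : ∀ (x : X) (a : D), p.mu x a ∈ Set.Icc (0 : ℝ) 1

open Classical in
/-- The objective function of the basic linear programming relaxation; infinite costs are
multiplied by the convention `∞ · 0 = 0`. -/
noncomputable def objective [Fintype S.Symbol] [Fintype X] [Fintype D]
    (I : ValuedStructure S X) (A : ValuedStructure S D) (p : LPPoint S X D) : ℝ≥0∞ :=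
  ∑ f : S.Symbol, ∑ x : Fin (S.arity f) → X, ∑ σ : LocalAssignment x D,
    (cost I A f x σ.tuple).toENNReal * ENNReal.ofReal (p.lam f x σ)

/-- The optimum of the basic linear programming relaxation of the instance in which the
variable `x` may only take values in `L x`. -/
noncomputable def blp [Fintype S.Symbol] [Fintype X] [Fintype D]
    (I : ValuedStructure S X) (A : ValuedStructure S D) (L : X → Set D) : ℝ≥0∞ :=
  ⨅ p ∈ {p : LPPoint S X D | p.IsFeasible ∧ ∀ x, ∀ a ∉ L x, p.mu x a = 0}, objective I A p

/-! ### Arc consistency -/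

/-- The domains `L x` of the variables are (generalised) arc consistent: for every constraint
`(f, x̄)`, every value in the domain of a variable in its scope extends to a finite-cost
assignment to the scope with values in the domains. -/
def IsArcConsistent (I : ValuedStructure S X) (A : ValuedStructure S D)
    (L : X → Set D) : Prop :=
  ∀ (f : S.Symbol) (x : Fin (S.arity f) → X) (y : Set.range x), ∀ a ∈ L y,
    ∃ σ : LocalAssignment x D, σ y = a ∧ (∀ z : Set.range x, σ z ∈ L z) ∧ cost I A f x σ.tuple ≠ ⊤

/-- The domains returned by the arc consistency algorithm: the largest arc consistent ones. -/
def acDomain (I : ValuedStructure S X) (A : ValuedStructure S D) (x : X) : Set D :=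
  {a | ∃ L : X → Set D, IsArcConsistent I A L ∧ a ∈ L x}

theorem isGreatest_acDomain (I : ValuedStructure S X) (A : ValuedStructure S D) :
    IsGreatest {L : X → Set D | IsArcConsistent I A L} (acDomain I A) := by
  refine ⟨?_, fun L hL x a ha => ⟨L, hL, ha⟩⟩
  rintro f x y a ⟨L, hL, ha⟩
  obtain ⟨σ, h1, h2, h3⟩ := hL f x y a ha
  exact ⟨σ, h1, fun z => ⟨L, hL, h2 z⟩, h3⟩

/-! ### The algorithm `BLP_g` -/

open Classical in
/-- The value computed by `BLP_g`: first establish arc consistency; if some domain becomes empty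
there is no solution of finite measure and the value is `∞`; otherwise solve the basic linear
programming relaxation of the arc consistent instance. -/
noncomputable def blpg [Fintype S.Symbol] [Fintype X] [Fintype D]
    (I : ValuedStructure S X) (A : ValuedStructure S D) : ℝ≥0∞ :=
  if ∃ x, acDomain I A x = ∅ then ⊤ else blp I A (acDomain I A)

/-- `BLP_g` solves `VCSP(A)`: it computes the optimum of every instance. -/
def SolvedByBLPg [Fintype S.Symbol] [Fintype D] (A : ValuedStructure S D) : Prop :=
  ∀ (X : Type w) [Fintype X] (I : ValuedStructure S X), blpg I A = opt I A

/-! ### Multimorphisms -/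

/-- The pair `⟨g₁, g₂⟩` is a binary multimorphism of `A`. -/
def IsMultimorphism (A : ValuedStructure S D) (g₁ g₂ : D → D → D) : Prop :=
  ∀ (f : S.Symbol) (s t : Fin (S.arity f) → D),
    A.val f (fun i => g₁ (s i) (t i)) + A.val f (fun i => g₂ (s i) (t i))
      ≤ A.val f s + A.val f t

end ValuedStructure

/-- `b` and `c` are distinct, and the partial order relates all pairs of elements except for
`b` and `c`. -/
structure OnlyUnrelatedPair {D : Type v} [PartialOrder D] (b c : D) : Prop where
  ne : b ≠ c
  not_le : ¬ b ≤ c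
  not_ge : ¬ c ≤ b
  related : ∀ x y : D, ({x, y} : Set D) ≠ {b, c} → x ≤ y ∨ y ≤ x

/-- The pair `⟨g₁, g₂⟩` is 1-defect with respect to `b`, `c` and the given order. -/
structure IsOneDefectPair {D : Type v} [PartialOrder D] (b c : D) (g₁ g₂ : D → D → D) :
    Prop where
  unrelated : OnlyUnrelatedPair b c
  comm₁ : ∀ x y, g₁ x y = g₁ y x
  comm₂ : ∀ x y, g₂ x y = g₂ y x
  meet : ∀ x y, ({x, y} : Set D) ≠ {b, c} → IsGLB {x, y} (g₁ x y)
  join : ∀ x y, ({x, y} : Set D) ≠ {b, c} → IsLUB {x, y} (g₂ x y)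
  defect_disjoint : ∀ x y, ({x, y} : Set D) = {b, c} →
    ({g₁ x y, g₂ x y} : Set D) ∩ {x, y} = ∅
  defect_lt : ∀ x y, ({x, y} : Set D) = {b, c} → g₁ x y < g₂ x y

/-! ### Generated symmetric operations -/

/-- An `m`-ary operation is symmetric if it is invariant under permuting its arguments. -/
def IsSymmetricOp {D : Type v} {m : ℕ} (h : (Fin m → D) → D) : Prop :=
  ∀ (π : Equiv.Perm (Fin m)) (x : Fin m → D), h (fun i => x (π i)) = h x

/-- A set of finitary operations (of positive arity) is a clone if it contains all projections
and is closed under superposition. -/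
structure IsClone {D : Type v} (C : (m : ℕ) → Set ((Fin m → D) → D)) : Prop where
  proj : ∀ (m : ℕ) (i : Fin m), (fun x => x i) ∈ C m
  superposition : ∀ (n m : ℕ), 0 < n → 0 < m → ∀ h ∈ C n, ∀ g : Fin n → (Fin m → D) → D,
    (∀ i, g i ∈ C m) → (fun x => h (fun i => g i x)) ∈ C m

/-- The operation `h` lies in the smallest clone containing the binary operation `g`. -/
def GeneratedByBinary {D : Type v} (g : D → D → D) {m : ℕ} (h : (Fin m → D) → D) : Prop :=
  ∀ C : (m : ℕ) → Set ((Fin m → D) → D), IsClone C → (fun x => g (x 0) (x 1)) ∈ C 2 → h ∈ C m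

/-! Both values of the defect avoid `b` and `c`, so incomparability of `b` and `c` forces `g₁ b c`
below both or `g₂ b c` above both (`IsOneDefectPair.lt_or_lt`). Hence, up to reversing the order,
one operation `g` of the pair lies below both of its arguments everywhere; nothing else about the
defect is needed.

For the linear program, replace each distribution of a feasible point by the law of `g` (or of its
partner `g'`) applied to two independent samples. Feasibility survives, and by the multimorphism
inequality the two new objectives add up to at most twice the old one
(`IsMultimorphism.objective_add_le`). So `g` maps optimal points of finite value to optimal points.
Among the optimal points, take one of least total expected rank, for a strictly monotone `rank : D →
ℝ`. Applying `g` cannot lower this rank further, which forces every `μ_x` to be a point mass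
(`eq_of_sum_rank_binaryLaw_ge`), and the optimum is attained by a solution (`opt_le_objective`).
This bound ignores the domains `L`; arc consistency only has to keep every solution of finite
measure (`blpg_le_opt`).

For the clone, a pointwise minimal `m`-ary operation generated by `g` is the least one, hence
symmetric. -/

/-! ### Additivity and monotonicity of the embedding into `[0, ∞]` -/

theorem ExtRat.toENNReal_zero : ExtRat.toENNReal 0 = 0 := by
  rw [← WithTop.coe_zero, ExtRat.toENNReal_coe]
  simp

theorem ExtRat.toENNReal_add (p q : ExtRat) :
    ExtRat.toENNReal (p + q) = p.toENNReal + q.toENNReal := by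
  induction p using WithTop.recTopCoe with
  | top => simp [ExtRat.toENNReal_top]
  | coe p =>
    induction q using WithTop.recTopCoe with
    | top => simp [ExtRat.toENNReal_top]
    | coe q =>
      rw [← WithTop.coe_add, ExtRat.toENNReal_coe, ExtRat.toENNReal_coe, ExtRat.toENNReal_coe]
      push_cast
      rfl

theorem ExtRat.toENNReal_sum {ι : Type*} (s : Finset ι) (q : ι → ExtRat) :
    ExtRat.toENNReal (∑ i ∈ s, q i) = ∑ i ∈ s, (q i).toENNReal := by
  classical
  induction s using Finset.induction_on with
  | empty => simp [ExtRat.toENNReal_zero]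
  | insert i s hi ih => rw [Finset.sum_insert hi, Finset.sum_insert hi, ExtRat.toENNReal_add, ih]

theorem ExtRat.toENNReal_mono : Monotone ExtRat.toENNReal := by
  intro p q h
  obtain ⟨r, rfl⟩ := exists_add_of_le h
  rw [ExtRat.toENNReal_add]
  exact le_self_add

/-! ### Symmetric operations in the clone of an operation below its arguments -/

section Clone

variable {D : Type v} {g : D → D → D} {m : ℕ}

theorem GeneratedByBinary.proj (i : Fin m) :
    GeneratedByBinary g (fun x : Fin m → D => x i) :=
  fun _ hC _ => hC.proj m i

theorem GeneratedByBinary.comp₂ (hm : 0 < m) {h k : (Fin m → D) → D}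
    (hh : GeneratedByBinary g h) (hk : GeneratedByBinary g k) :
    GeneratedByBinary g (fun x => g (h x) (k x)) := by
  intro C hC hg
  have := hC.superposition 2 m two_pos hm _ hg ![h, k] (by
    intro i
    fin_cases i
    · exact hh C hC hg
    · exact hk C hC hg)
  simpa using this

theorem GeneratedByBinary.reindex (hm : 0 < m) {h : (Fin m → D) → D}
    (hh : GeneratedByBinary g h) (π : Fin m → Fin m) :
    GeneratedByBinary g (fun x => h (fun i => x (π i))) :=
  fun C hC hg => hC.superposition m m hm hm h (hh C hC hg) (fun i x => x (π i))
    (fun i => hC.proj m (π i))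

/-- The least operation generated by `g` is symmetric. -/
theorem exists_isSymmetricOp_of_le [Finite D] [PartialOrder D]
    (hl : ∀ x y, g x y ≤ x) (hr : ∀ x y, g x y ≤ y) (hm : 0 < m) :
    ∃ h : (Fin m → D) → D, GeneratedByBinary g h ∧ IsSymmetricOp h := by
  obtain ⟨h, hh, hmin⟩ := (Set.toFinite
    {h : (Fin m → D) → D | GeneratedByBinary g h}).exists_minimal ⟨_, .proj ⟨0, hm⟩⟩
  -- `g(h, k)` is generated and lies below `h`, so minimality gives `h ≤ g(h, k) ≤ k`: minimal
  -- implies least.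
  have hle : ∀ k : (Fin m → D) → D, GeneratedByBinary g k → h ≤ k := fun k hk =>
    (hmin (GeneratedByBinary.comp₂ hm hh hk) (fun x => hl _ _)).trans (fun x => hr _ _)
  refine ⟨h, hh, fun π x => le_antisymm ?_ (hle _ (hh.reindex hm π) x)⟩
  simpa using hle _ (hh.reindex hm π.symm) (fun i => x (π i))

end Clone

/-! ### The law of a binary operation applied to two independent samples -/

section Law

variable {α : Type*} {β : Type*} [Fintype α] [Fintype β]

open Classical in
/-- The distribution of `g a a'` when `a` and `a'` are independent with distribution `w`. -/
noncomputable def binaryLaw (g : α → α → α) (w : α → ℝ) (d : α) : ℝ :=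
  ∑ a, ∑ a', if g a a' = d then w a * w a' else 0

theorem binaryLaw_nonneg (g : α → α → α) {w : α → ℝ} (hw : ∀ a, 0 ≤ w a) (d : α) :
    0 ≤ binaryLaw g w d :=
  Finset.sum_nonneg fun a _ => Finset.sum_nonneg fun a' _ => by
    split_ifs
    · exact mul_nonneg (hw a) (hw a')
    · exact le_rfl

theorem sum_mul_binaryLaw (g : α → α → α) (w F : α → ℝ) :
    ∑ d, F d * binaryLaw g w d = ∑ a, ∑ a', F (g a a') * (w a * w a') := by
  classical
  simp only [binaryLaw, Finset.mul_sum]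
  rw [Finset.sum_comm]
  refine Finset.sum_congr rfl fun a _ => ?_
  rw [Finset.sum_comm]
  refine Finset.sum_congr rfl fun a' _ => ?_
  simp

/-- The `[0, ∞]`-valued change of variables, needed because costs may be infinite; the real version
serves marginals and ranks. -/
theorem sum_mul_ofReal_binaryLaw (g : α → α → α) {w : α → ℝ} (hw : ∀ a, 0 ≤ w a)
    (F : α → ℝ≥0∞) :
    ∑ d, F d * ENNReal.ofReal (binaryLaw g w d) =
      ∑ a, ∑ a', F (g a a') * (ENNReal.ofReal (w a) * ENNReal.ofReal (w a')) := by
  classical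
  have key : ∀ d, ENNReal.ofReal (binaryLaw g w d) = ∑ a, ∑ a',
      if g a a' = d then ENNReal.ofReal (w a) * ENNReal.ofReal (w a') else 0 := by
    intro d
    have h0 : ∀ a a', 0 ≤ if g a a' = d then w a * w a' else 0 := fun a a' => by
      split_ifs
      · exact mul_nonneg (hw a) (hw a')
      · exact le_rfl
    rw [binaryLaw, ENNReal.ofReal_sum_of_nonneg
      fun a _ => Finset.sum_nonneg fun a' _ => by convert h0 a a']
    refine Finset.sum_congr rfl fun a _ => ?_
    rw [ENNReal.ofReal_sum_of_nonneg fun a' _ => by convert h0 a a']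
    refine Finset.sum_congr rfl fun a' _ => ?_
    split_ifs
    · exact ENNReal.ofReal_mul (hw a)
    · simp
  simp only [key, Finset.mul_sum]
  rw [Finset.sum_comm]
  refine Finset.sum_congr rfl fun a _ => ?_
  rw [Finset.sum_comm]
  refine Finset.sum_congr rfl fun a' _ => ?_
  simp

theorem sum_binaryLaw (g : α → α → α) {w : α → ℝ} (hw : ∑ a, w a = 1) :
    ∑ d, binaryLaw g w d = 1 := by
  have := sum_mul_binaryLaw g w (fun _ => 1)
  simp only [one_mul] at this
  rw [this, ← Finset.sum_mul_sum, hw, one_mul]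

open Classical in
-- Images under `φ` of independent samples are independent, and `φ` carries `g` to `k`. With `φ` the
-- evaluation of local assignments at a variable, this preserves the marginal constraints.
theorem binaryLaw_marginal {g : α → α → α} {k : β → β → β} {φ : α → β}
    (hφ : ∀ a a', φ (g a a') = k (φ a) (φ a')) {w : α → ℝ} {μ : β → ℝ}
    (h : ∀ b, ∑ a with φ a = b, w a = μ b) (b : β) :
    ∑ a with φ a = b, binaryLaw g w a = binaryLaw k μ b := by
  have h1 := sum_mul_binaryLaw g w (fun a => if φ a = b then 1 else 0)
  simp only [ite_mul, one_mul, zero_mul, hφ] at h1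
  rw [Finset.sum_filter, h1, binaryLaw]
  have h2 : ∀ F : β → ℝ, ∑ a, F (φ a) * w a = ∑ y, F y * μ y := by
    intro F
    simp only [← h, Finset.mul_sum, Finset.sum_filter]
    rw [Finset.sum_comm]
    refine Finset.sum_congr rfl fun a _ => ?_
    simp
  have h3 : ∀ a, ∑ a', (if k (φ a) (φ a') = b then w a * w a' else 0) =
      (∑ y', if k (φ a) y' = b then μ y' else 0) * w a := by
    intro a
    have := h2 (fun y' => if k (φ a) y' = b then 1 else 0)
    simp only [ite_mul, one_mul, zero_mul] at this
    rw [← this, Finset.sum_mul]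
    refine Finset.sum_congr rfl fun a' _ => ?_
    split_ifs
    · ring
    · simp
  simp only [h3]
  rw [h2 (fun y => ∑ y', if k y y' = b then μ y' else 0)]
  refine Finset.sum_congr rfl fun y _ => ?_
  rw [Finset.sum_mul]
  refine Finset.sum_congr rfl fun y' _ => ?_
  split_ifs
  · ring
  · simp

end Law

namespace ValuedStructure

variable {S : VSignature.{u}} {D : Type v} {X : Type w}

/-! ### The multimorphism inequality for costs -/

theorem IsMultimorphism.swap {A : ValuedStructure S D} {g₁ g₂ : D → D → D}
    (h : A.IsMultimorphism g₁ g₂) : A.IsMultimorphism g₂ g₁ := fun f s t => by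
  rw [add_comm]
  exact h f s t

theorem IsMultimorphism.cost_add_le {A : ValuedStructure S D} {g₁ g₂ : D → D → D}
    (h : A.IsMultimorphism g₁ g₂) (I : ValuedStructure S X) (f : S.Symbol)
    (x : Fin (S.arity f) → X) (s t : Fin (S.arity f) → D) :
    (cost I A f x (fun i => g₁ (s i) (t i))).toENNReal +
      (cost I A f x (fun i => g₂ (s i) (t i))).toENNReal ≤
    (cost I A f x s).toENNReal + (cost I A f x t).toENNReal := by
  rw [← ExtRat.toENNReal_add, ← ExtRat.toENNReal_add]
  apply ExtRat.toENNReal_mono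
  simp only [cost, ← mul_add]
  exact mul_le_mul_right (h f s t) _

/-! ### Integral points of the linear program -/

open Classical in
/-- The point of the linear program given by the solution `h`. -/
noncomputable def LPPoint.ofSolution (S : VSignature.{u}) (h : X → D) : LPPoint S X D where
  lam _ x σ := if σ = fun z : Set.range x => h z then 1 else 0
  mu x a := if a = h x then 1 else 0

theorem LPPoint.ofSolution_isFeasible [Fintype X] [Fintype D] (h : X → D) :
    (LPPoint.ofSolution S h).IsFeasible where
  marginal f x y a := by
    classical
    simp only [ofSolution, Finset.sum_filter]
    rw [Finset.sum_eq_single (fun z : Set.range x => h z)]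
    · simp [eq_comm]
    · intro σ _ hσ
      simp [hσ]
    · simp
  total x := by
    classical
    simp [ofSolution]
  lam_mem f x σ := by
    simp only [ofSolution]
    split_ifs <;> simp
  mu_mem x a := by
    simp only [ofSolution]
    split_ifs <;> simp

theorem objective_ofSolution [Fintype S.Symbol] [Fintype X] [Fintype D]
    (I : ValuedStructure S X) (A : ValuedStructure S D) (h : X → D) :
    objective I A (LPPoint.ofSolution S h) = (measure I A h).toENNReal := by
  classical
  simp only [objective, measure, ExtRat.toENNReal_sum]
  refine Finset.sum_congr rfl fun f _ => Finset.sum_congr rfl fun x _ => ?_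
  rw [Finset.sum_eq_single (fun z : Set.range x => h z)]
  · simp only [LPPoint.ofSolution, if_true, ENNReal.ofReal_one, mul_one]
    rfl
  · intro σ _ hσ
    simp [LPPoint.ofSolution, hσ]
  · simp

theorem cost_ne_top_of_measure_ne_top [Fintype S.Symbol] [Fintype X]
    {I : ValuedStructure S X} {A : ValuedStructure S D} {h : X → D}
    (hm : (measure I A h).toENNReal ≠ ⊤) (f : S.Symbol) (x : Fin (S.arity f) → X) :
    cost I A f x (fun i => h (x i)) ≠ ⊤ := by
  intro hc
  apply hm
  simp only [measure, ExtRat.toENNReal_sum]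
  rw [ENNReal.sum_eq_top]
  refine ⟨f, Finset.mem_univ _, ?_⟩
  rw [ENNReal.sum_eq_top]
  exact ⟨x, Finset.mem_univ _, by rw [hc, ExtRat.toENNReal_top]⟩

/-- The singletons `{h x}` already form arc consistent domains. -/
theorem mem_acDomain_of_measure_ne_top [Fintype S.Symbol] [Fintype X]
    {I : ValuedStructure S X} {A : ValuedStructure S D} {h : X → D}
    (hm : (measure I A h).toENNReal ≠ ⊤) (x : X) : h x ∈ acDomain I A x := by
  refine ⟨fun x => {h x}, ?_, rfl⟩
  rintro f x y a rfl
  exact ⟨fun z => h z, rfl, fun z => rfl, cost_ne_top_of_measure_ne_top hm f x⟩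

/-- `BLP_g` is a relaxation. -/
theorem blpg_le_opt [Fintype S.Symbol] [Fintype X] [Fintype D]
    (I : ValuedStructure S X) (A : ValuedStructure S D) : blpg I A ≤ opt I A := by
  refine le_iInf fun h => ?_
  by_cases hm : (measure I A h).toENNReal = ⊤
  · rw [hm]
    exact le_top
  have hmem := mem_acDomain_of_measure_ne_top hm
  rw [blpg, if_neg (by
    rintro ⟨x, hx⟩
    simpa [hx] using hmem x), blp, ← objective_ofSolution]
  refine iInf₂_le (LPPoint.ofSolution S h) ⟨LPPoint.ofSolution_isFeasible h, ?_⟩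
  intro x a ha
  have : a ≠ h x := fun e => ha (e ▸ hmem x)
  simp [LPPoint.ofSolution, this]

/-! ### Applying a binary operation to a point of the linear program -/

open Classical in
/-- Apply `g` to two independent samples of each distribution. -/
noncomputable def LPPoint.mapBinary [Fintype D] (g : D → D → D) (p : LPPoint S X D) :
    LPPoint S X D where
  lam f x := binaryLaw (fun σ σ' z => g (σ z) (σ' z)) (p.lam f x)
  mu x := binaryLaw g (p.mu x)

theorem LPPoint.IsFeasible.sum_lam [Fintype X] [Fintype D] {p : LPPoint S X D}
    (hp : p.IsFeasible) (f : S.Symbol) (x : Fin (S.arity f) → X)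
    [Fintype (LocalAssignment x D)] : ∑ σ, p.lam f x σ = 1 := by
  classical
  -- Positive arity supplies a variable in the scope, whose marginal has total mass one.
  have y : Set.range x := ⟨x ⟨0, S.arity_pos f⟩, Set.mem_range_self _⟩
  rw [← hp.total y, ← Finset.sum_fiberwise Finset.univ (fun σ : LocalAssignment x D => σ y)]
  refine Finset.sum_congr rfl fun a _ => ?_
  rw [← hp.marginal f x y a]
  convert rfl

theorem LPPoint.IsFeasible.mapBinary [Fintype X] [Fintype D] {p : LPPoint S X D}
    (hp : p.IsFeasible) (g : D → D → D) : (p.mapBinary g).IsFeasible := by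
  classical
  have hl0 : ∀ f x σ, 0 ≤ (p.mapBinary g).lam f x σ := fun f x σ =>
    binaryLaw_nonneg _ (fun σ => (hp.lam_mem f x σ).1) σ
  have hm0 : ∀ x a, 0 ≤ (p.mapBinary g).mu x a := fun x a =>
    binaryLaw_nonneg _ (fun a => (hp.mu_mem x a).1) a
  have hm1 : ∀ x, ∑ a, (p.mapBinary g).mu x a = 1 := fun x => sum_binaryLaw _ (hp.total x)
  refine ⟨fun f x y a => ?_, hm1, fun f x σ => ⟨hl0 f x σ, ?_⟩, fun x a => ⟨hm0 x a, ?_⟩⟩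
  · have := binaryLaw_marginal (g := fun (σ σ' : LocalAssignment x D) z => g (σ z) (σ' z))
      (k := g) (φ := fun σ => σ y) (fun _ _ => rfl) (w := p.lam f x) (μ := p.mu y)
      (fun b => by rw [← hp.marginal f x y b]) a
    convert this <;> rfl
  · rw [← sum_binaryLaw (fun (σ σ' : LocalAssignment x D) z => g (σ z) (σ' z))
      (hp.sum_lam f x)]
    exact Finset.single_le_sum (f := (p.mapBinary g).lam f x) (fun σ _ => hl0 f x σ)
      (Finset.mem_univ σ)
  · rw [← hm1 x]
    exact Finset.single_le_sum (fun a _ => hm0 x a) (Finset.mem_univ a)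

open Classical in
theorem objective_mapBinary [Fintype S.Symbol] [Fintype X] [Fintype D]
    (I : ValuedStructure S X) (A : ValuedStructure S D) (g : D → D → D) {p : LPPoint S X D}
    (hp : ∀ f x σ, 0 ≤ p.lam f x σ) :
    objective I A (p.mapBinary g) = ∑ f : S.Symbol, ∑ x : Fin (S.arity f) → X,
      ∑ σ : LocalAssignment x D, ∑ σ' : LocalAssignment x D,
        (cost I A f x (fun i => g (σ.tuple i) (σ'.tuple i))).toENNReal *
          (ENNReal.ofReal (p.lam f x σ) * ENNReal.ofReal (p.lam f x σ')) := by
  refine Finset.sum_congr rfl fun f _ => Finset.sum_congr rfl fun x _ => ?_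
  have := sum_mul_ofReal_binaryLaw (fun (σ σ' : LocalAssignment x D) z => g (σ z) (σ' z))
    (hp f x) (fun σ => (cost I A f x σ.tuple).toENNReal)
  convert this <;> rfl

/-- The multimorphism inequality for each pair `σ`, `σ'`, averaged over independent samples. -/
theorem IsMultimorphism.objective_add_le [Fintype S.Symbol] [Fintype X] [Fintype D]
    {A : ValuedStructure S D} {g₁ g₂ : D → D → D} (h : A.IsMultimorphism g₁ g₂)
    (I : ValuedStructure S X) {p : LPPoint S X D} (hp : p.IsFeasible) :
    objective I A (p.mapBinary g₁) + objective I A (p.mapBinary g₂) ≤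
      objective I A p + objective I A p := by
  classical
  have h0 : ∀ f x σ, 0 ≤ p.lam f x σ := fun f x σ => (hp.lam_mem f x σ).1
  rw [objective_mapBinary I A g₁ h0, objective_mapBinary I A g₂ h0]
  simp only [objective, ← Finset.sum_add_distrib]
  refine Finset.sum_le_sum fun f _ => Finset.sum_le_sum fun x _ => ?_
  have hone : ∑ σ : LocalAssignment x D, ENNReal.ofReal (p.lam f x σ) = 1 := by
    rw [← ENNReal.ofReal_sum_of_nonneg (fun σ _ => h0 f x σ), hp.sum_lam f x, ENNReal.ofReal_one]
  -- Since the weights sum to one, twice the expected cost is the expected sum of the costs of two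
  -- independent samples.
  have hR : ∑ σ : LocalAssignment x D,
      ((cost I A f x σ.tuple).toENNReal * ENNReal.ofReal (p.lam f x σ) +
        (cost I A f x σ.tuple).toENNReal * ENNReal.ofReal (p.lam f x σ)) =
      ∑ σ : LocalAssignment x D, ∑ σ' : LocalAssignment x D,
        ((cost I A f x σ.tuple).toENNReal + (cost I A f x σ'.tuple).toENNReal) *
          (ENNReal.ofReal (p.lam f x σ) * ENNReal.ofReal (p.lam f x σ')) := by
    simp only [add_mul, Finset.sum_add_distrib]
    congr 1
    · refine Finset.sum_congr rfl fun σ _ => ?_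
      rw [← Finset.mul_sum, ← Finset.mul_sum, hone, mul_one]
    · rw [Finset.sum_comm]
      refine Finset.sum_congr rfl fun σ _ => ?_
      rw [← Finset.mul_sum, ← Finset.sum_mul, hone, one_mul]
  convert_to _ ≤ ∑ σ : LocalAssignment x D,
      ((cost I A f x σ.tuple).toENNReal * ENNReal.ofReal (p.lam f x σ) +
        (cost I A f x σ.tuple).toENNReal * ENNReal.ofReal (p.lam f x σ))
  rw [hR]
  refine Finset.sum_le_sum fun σ _ => Finset.sum_le_sum fun σ' _ => ?_
  rw [← add_mul]
  exact mul_le_mul' (h.cost_add_le I f x σ.tuple σ'.tuple) le_rfl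

/-! ### Optimal points of the linear program -/

/-- The point of the linear program with given coordinates. -/
def LPPoint.ofProd
    (e : ((f : S.Symbol) → (x : Fin (S.arity f) → X) → LocalAssignment x D → ℝ) × (X → D → ℝ)) :
    LPPoint S X D := ⟨e.1, e.2⟩

theorem LPPoint.isCompact_isFeasible [Fintype X] [Fintype D] :
    IsCompact {e | (LPPoint.ofProd (S := S) (X := X) (D := D) e).IsFeasible} := by
  classical
  refine (isCompact_Icc (a := 0) (b := 1)).of_isClosed_subset ?_ ?_
  · have : {e | (LPPoint.ofProd (S := S) (X := X) (D := D) e).IsFeasible} =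
        {e | (∀ (f : S.Symbol) (x : Fin (S.arity f) → X) (y : Set.range x) (a : D),
          ∑ σ : LocalAssignment x D with σ y = a, e.1 f x σ = e.2 y a) ∧
          (∀ x : X, ∑ a : D, e.2 x a = 1) ∧
          (∀ (f : S.Symbol) (x : Fin (S.arity f) → X) (σ : LocalAssignment x D),
            e.1 f x σ ∈ Set.Icc (0 : ℝ) 1) ∧
          ∀ (x : X) (a : D), e.2 x a ∈ Set.Icc (0 : ℝ) 1} := by
      ext e
      constructor
      · rintro ⟨h1, h2, h3, h4⟩
        exact ⟨fun f x y a => by convert h1 f x y a <;> rfl, h2, h3, h4⟩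
      · rintro ⟨h1, h2, h3, h4⟩
        exact ⟨fun f x y a => by convert h1 f x y a <;> rfl, h2, h3, h4⟩
    rw [this]
    simp only [Set.ofPred_and, Set.ofPred_forall, Set.mem_Icc]
    refine .inter ?_ (.inter ?_ (.inter ?_ ?_))
    · exact isClosed_iInter fun f => isClosed_iInter fun x => isClosed_iInter fun y =>
        isClosed_iInter fun a => isClosed_eq (by fun_prop) (by fun_prop)
    · exact isClosed_iInter fun x => isClosed_eq (by fun_prop) (by fun_prop)
    · exact isClosed_iInter fun f => isClosed_iInter fun x => isClosed_iInter fun σ =>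
        (isClosed_le (by fun_prop) (by fun_prop)).inter (isClosed_le (by fun_prop) (by fun_prop))
    · exact isClosed_iInter fun x => isClosed_iInter fun a =>
        (isClosed_le (by fun_prop) (by fun_prop)).inter (isClosed_le (by fun_prop) (by fun_prop))
  · intro e he
    exact ⟨⟨fun f x σ => (he.lam_mem f x σ).1, fun x a => (he.mu_mem x a).1⟩,
      ⟨fun f x σ => (he.lam_mem f x σ).2, fun x a => (he.mu_mem x a).2⟩⟩

theorem lowerSemicontinuous_objective [Fintype S.Symbol] [Fintype X] [Fintype D]
    (I : ValuedStructure S X) (A : ValuedStructure S D) :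
    LowerSemicontinuous fun e => objective I A (LPPoint.ofProd (S := S) (X := X) (D := D) e) := by
  classical
  refine lowerSemicontinuous_sum fun f _ => lowerSemicontinuous_sum fun x _ =>
    lowerSemicontinuous_sum fun σ _ => ?_
  have hc : Continuous fun e : ((f : S.Symbol) → (x : Fin (S.arity f) → X) →
      LocalAssignment x D → ℝ) × (X → D → ℝ) => ENNReal.ofReal (e.1 f x σ) :=
    ENNReal.continuous_ofReal.comp (by fun_prop)
  generalize (cost I A f x σ.tuple).toENNReal = q
  by_cases hq : q = ⊤
  · subst hq
    -- `t ↦ ∞ · t` jumps at `0`, but it is the supremum of the continuous maps `t ↦ n · t`.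
    simp only [← ENNReal.iSup_natCast, ENNReal.iSup_mul]
    exact lowerSemicontinuous_iSup fun n =>
      ((ENNReal.continuous_const_mul (ENNReal.natCast_ne_top n)).comp hc).lowerSemicontinuous
  · exact ((ENNReal.continuous_const_mul hq).comp hc).lowerSemicontinuous

/-- A distribution whose expected rank does not drop under `g` is a point mass. -/
theorem eq_of_sum_rank_binaryLaw_ge [Fintype D] [PartialOrder D] {g : D → D → D}
    (hl : ∀ x y, g x y ≤ x) (hr : ∀ x y, g x y ≤ y) {ι : Type*} [Fintype ι] {μ : ι → D → ℝ}
    (h0 : ∀ x a, 0 ≤ μ x a) (h1 : ∀ x, ∑ a, μ x a = 1) {rank : D → ℝ} (hrank : StrictMono rank)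
    (h : ∑ x, ∑ a, rank a * μ x a ≤ ∑ x, ∑ a, rank a * binaryLaw g (μ x) a)
    {x : ι} {a a' : D} (ha : 0 < μ x a) (ha' : 0 < μ x a') : a = a' := by
  have hterm : ∀ x a a', 0 ≤ (rank a - rank (g a a')) * (μ x a * μ x a') := fun x a a' =>
    mul_nonneg (sub_nonneg.2 (hrank.monotone (hl a a'))) (mul_nonneg (h0 x a) (h0 x a'))
  -- The expected drop in rank is a sum of nonnegative terms and by `h` at most zero, so every term
  -- vanishes.
  have hsum : ∑ x, ∑ a, ∑ a', (rank a - rank (g a a')) * (μ x a * μ x a') = 0 := by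
    apply le_antisymm _ (Finset.sum_nonneg fun x _ => Finset.sum_nonneg fun a _ =>
      Finset.sum_nonneg fun a' _ => hterm x a a')
    have : ∀ x a, rank a * μ x a = ∑ a', rank a * (μ x a * μ x a') := fun x a => by
      rw [← Finset.mul_sum, ← Finset.mul_sum, h1, mul_one]
    simp only [sum_mul_binaryLaw] at h
    simp only [sub_mul, Finset.sum_sub_distrib, ← this]
    linarith
  have hzero : ∀ x a a', (rank a - rank (g a a')) * (μ x a * μ x a') = 0 := by
    intro x a a'
    rw [Finset.sum_eq_zero_iff_of_nonneg fun x _ => Finset.sum_nonneg fun a _ =>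
      Finset.sum_nonneg fun a' _ => hterm x a a'] at hsum
    have h2 := hsum x (Finset.mem_univ _)
    rw [Finset.sum_eq_zero_iff_of_nonneg fun a _ =>
      Finset.sum_nonneg fun a' _ => hterm x a a'] at h2
    have h3 := h2 a (Finset.mem_univ _)
    rw [Finset.sum_eq_zero_iff_of_nonneg fun a' _ => hterm x a a'] at h3
    exact h3 a' (Finset.mem_univ _)
  -- On the support the rank does not drop, so `g a a' = a`, which lies below `a'`.
  have hge : ∀ a a', 0 < μ x a → 0 < μ x a' → a ≤ a' := by
    intro a a' ha ha'
    have h4 : rank a = rank (g a a') := by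
      have := hzero x a a'
      have hne : μ x a * μ x a' ≠ 0 := (mul_pos ha ha').ne'
      exact sub_eq_zero.1 ((mul_eq_zero.1 this).resolve_right hne)
    have h5 : g a a' = a := by
      by_contra hne
      exact (hrank (lt_of_le_of_ne (hl a a') hne)).ne' h4
    rw [← h5]
    exact hr a a'
  exact le_antisymm (hge a a' ha ha') (hge a' a ha' ha)

theorem exists_strictMono_real [Fintype D] [PartialOrder D] : ∃ r : D → ℝ, StrictMono r := by
  classical
  -- The rank of `a` is the number of elements strictly below it.
  refine ⟨fun a => ((Finset.univ.filter (· < a)).card : ℝ), fun a a' h => ?_⟩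
  refine Nat.cast_lt.2 (Finset.card_lt_card ⟨?_, ?_⟩)
  · intro y
    simp only [Finset.mem_filter, Finset.mem_univ, true_and]
    exact fun hy => hy.trans h
  · intro hsub
    have := @hsub a (by simpa using h)
    simp at this

/-- A feasible point all of whose `μ_x` are concentrated on single values has at least the
objective of the corresponding solution. -/
theorem LPPoint.IsFeasible.measure_le_objective [Fintype S.Symbol] [Fintype X] [Fintype D]
    (I : ValuedStructure S X) (A : ValuedStructure S D) {p : LPPoint S X D}
    (hp : p.IsFeasible) {h : X → D} (hh : ∀ x a, a ≠ h x → p.mu x a = 0) :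
    (measure I A h).toENNReal ≤ objective I A p := by
  classical
  simp only [objective, measure, ExtRat.toENNReal_sum]
  refine Finset.sum_le_sum fun f _ => Finset.sum_le_sum fun x _ => ?_
  have hzero : ∀ σ : LocalAssignment x D, σ ≠ (fun z : Set.range x => h z) →
      p.lam f x σ = 0 := by
    intro σ hσ
    obtain ⟨z, hz⟩ := Function.ne_iff.1 hσ
    have hm := hp.marginal f x z (σ z)
    rw [hh z _ hz, Finset.sum_eq_zero_iff_of_nonneg fun σ _ => (hp.lam_mem f x σ).1] at hm
    exact hm σ (by simp)
  have hone : p.lam f x (fun z : Set.range x => h z) = 1 := by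
    rw [← hp.sum_lam f x]
    symm
    apply Finset.sum_eq_single
    · exact fun σ _ hσ => hzero σ hσ
    · simp
  refine le_trans ?_ (Finset.single_le_sum (fun _ _ => zero_le)
    (Finset.mem_univ (fun z : Set.range x => h z)))
  rw [hone, ENNReal.ofReal_one, mul_one]
  exact le_rfl

theorem opt_le_objective [Fintype S.Symbol] [Fintype X] [Fintype D] [Nonempty D] [PartialOrder D]
    {A : ValuedStructure S D} {g g' : D → D → D} (hA : A.IsMultimorphism g g')
    (hl : ∀ x y, g x y ≤ x) (hr : ∀ x y, g x y ≤ y) (I : ValuedStructure S X)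
    {p : LPPoint S X D} (hp : p.IsFeasible) : opt I A ≤ objective I A p := by
  classical
  obtain ⟨rank, hrank⟩ := exists_strictMono_real (D := D)
  have hlsc := lowerSemicontinuous_objective I A
  obtain ⟨e₀, he₀, hmin₀⟩ := LowerSemicontinuousOn.exists_isMinOn ⟨(p.lam, p.mu), hp⟩
    LPPoint.isCompact_isFeasible (hlsc.lowerSemicontinuousOn _)
  have hopt : ∀ q : LPPoint S X D, q.IsFeasible →
      objective I A (LPPoint.ofProd e₀) ≤ objective I A q :=
    fun q hq => hmin₀ (a := (q.lam, q.mu)) hq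
  refine le_trans ?_ (hopt p hp)
  generalize hO : objective I A (LPPoint.ofProd e₀) = O at hopt
  by_cases hOtop : O = ⊤
  · rw [hOtop]
    exact le_top
  -- The set of optimal points: lower semicontinuity makes the sublevel set closed, hence the
  -- intersection compact.
  have hK := LPPoint.isCompact_isFeasible (S := S) (X := X) (D := D) |>.inter_right
    (hlsc.isClosed_preimage O)
  obtain ⟨e₁, ⟨he₁, hO₁⟩, hmin₁⟩ := hK.exists_isMinOn ⟨e₀, he₀, hO.le⟩
    (f := fun e => ∑ x, ∑ a, rank a * e.2 x a) (by fun_prop)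
  have hq : (LPPoint.ofProd e₁).IsFeasible := he₁
  have hqO : objective I A (LPPoint.ofProd e₁) ≤ O := hO₁
  have hrO : objective I A ((LPPoint.ofProd e₁).mapBinary g) ≤ O := by
    have h1 := hA.objective_add_le I hq
    have h2 := hopt _ (hq.mapBinary g')
    -- The image under `g'` costs at least `O`; cancelling this `O` is legitimate because it is
    -- finite.
    refine (ENNReal.add_le_add_iff_right hOtop).1 ?_
    exact (add_le_add le_rfl h2).trans (h1.trans (add_le_add hqO hqO))
  have hrank_le : ∑ x, ∑ a, rank a * e₁.2 x a ≤ ∑ x, ∑ a, rank a * binaryLaw g (e₁.2 x) a :=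
    hmin₁ (a := (((LPPoint.ofProd e₁).mapBinary g).lam, ((LPPoint.ofProd e₁).mapBinary g).mu))
      ⟨hq.mapBinary g, hrO⟩
  have hpos : ∀ x, ∃ a, 0 < e₁.2 x a := by
    intro x
    by_contra! hneg
    have := hq.total x
    have h2 := Finset.sum_nonpos fun a (_ : a ∈ Finset.univ) => hneg a
    simp only [LPPoint.ofProd] at this
    linarith
  choose h hh using hpos
  refine (iInf_le _ h).trans ((hq.measure_le_objective I A fun x a ha => ?_).trans hqO)
  have h0 : ∀ x a, 0 ≤ e₁.2 x a := fun x a => (hq.mu_mem x a).1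
  by_contra hne
  exact ha (eq_of_sum_rank_binaryLaw_ge hl hr h0 hq.total hrank hrank_le
    (lt_of_le_of_ne (h0 x a) (Ne.symm hne)) (hh x))

/-- `BLP_g` solves `VCSP(A)` if `A` has a binary multimorphism one of whose operations is below
both of its arguments in some partial order. -/
theorem IsMultimorphism.solvedByBLPg [Fintype S.Symbol] [Fintype D] [Nonempty D] [PartialOrder D]
    {A : ValuedStructure S D} {g g' : D → D → D} (hA : A.IsMultimorphism g g')
    (hl : ∀ x y, g x y ≤ x) (hr : ∀ x y, g x y ≤ y) : SolvedByBLPg.{u, v, w} A := by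
  intro X _ I
  refine le_antisymm (blpg_le_opt I A) ?_
  rw [blpg]
  split_ifs
  · exact le_top
  · exact le_iInf₂ fun p hp => opt_le_objective hA hl hr I hp.1

end ValuedStructure

/-! ### 1-defect pairs -/

namespace IsOneDefectPair

variable {D : Type v} [PartialOrder D] {b c : D} {g₁ g₂ : D → D → D}

theorem swap (h : IsOneDefectPair b c g₁ g₂) : IsOneDefectPair c b g₁ g₂ := by
  obtain ⟨⟨h1, h2, h3, h4⟩, h5, h6, h7, h8, h9, h10⟩ := h
  rw [Set.pair_comm b c] at h4 h7 h8 h9 h10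
  exact ⟨⟨h1.symm, h3, h2, h4⟩, h5, h6, h7, h8, h9, h10⟩

theorem dual (h : IsOneDefectPair b c g₁ g₂) :
    IsOneDefectPair (D := Dᵒᵈ) b c g₂ g₁ where
  unrelated := ⟨h.unrelated.ne, h.unrelated.not_ge, h.unrelated.not_le,
    fun x y hxy => (h.unrelated.related x y hxy).symm⟩
  comm₁ := h.comm₂
  comm₂ := h.comm₁
  meet := h.join
  join := h.meet
  defect_disjoint x y hxy :=
    (congrArg (· ∩ {x, y}) (Set.pair_comm (g₂ x y) (g₁ x y))).trans (h.defect_disjoint x y hxy)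
  defect_lt := h.defect_lt

theorem le_left (h : IsOneDefectPair b c g₁ g₂) (hb : g₁ b c ≤ b) (hc : g₁ b c ≤ c) (x y : D) :
    g₁ x y ≤ x := by
  by_cases hxy : ({x, y} : Set D) = {b, c}
  · rcases Set.pair_eq_pair_iff.1 hxy with ⟨rfl, rfl⟩ | ⟨rfl, rfl⟩
    · exact hb
    · rwa [h.comm₁]
  · exact (h.meet x y hxy).1 (by simp)

theorem le_right (h : IsOneDefectPair b c g₁ g₂) (hb : g₁ b c ≤ b) (hc : g₁ b c ≤ c) (x y : D) :
    g₁ x y ≤ y := by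
  rw [h.comm₁]
  exact h.le_left hb hc y x

/-- An element other than `b` and `c` is strictly comparable with `b`. -/
theorem lt_or_gt (h : IsOneDefectPair b c g₁ g₂) {x : D} (hb : x ≠ b) (hc : x ≠ c) :
    x < b ∨ b < x := by
  have := h.unrelated.related x b (fun e => by
    have hx : x ∈ ({b, c} : Set D) := e ▸ (by simp)
    simp [hb, hc] at hx)
  rcases this with h1 | h1
  · exact .inl (lt_of_le_of_ne h1 hb)
  · exact .inr (lt_of_le_of_ne h1 hb.symm)

/-- If `g₁ b c` is not below both, it is above one of `b`, `c`, and so is `g₂ b c`. Were `g₂ b c`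
below the other, `b` and `c` would be comparable; so it is above both. -/
theorem lt_or_lt (h : IsOneDefectPair b c g₁ g₂) :
    (g₁ b c < b ∧ g₁ b c < c) ∨ (b < g₂ b c ∧ c < g₂ b c) := by
  have hd := h.defect_disjoint b c rfl
  have hlt := h.defect_lt b c rfl
  have hn : ∀ z ∈ ({g₁ b c, g₂ b c} : Set D), z ≠ b ∧ z ≠ c := fun z hz => by
    constructor <;> rintro rfl <;> exact (Set.eq_empty_iff_forall_notMem.1 hd) _ ⟨hz, by simp⟩
  obtain ⟨h1b, h1c⟩ := hn (g₁ b c) (by simp)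
  obtain ⟨h2b, h2c⟩ := hn (g₂ b c) (by simp)
  have hbc := h.unrelated.not_le
  have hcb := h.unrelated.not_ge
  rcases h.lt_or_gt h1b h1c with p | p <;> rcases h.swap.lt_or_gt h1c h1b with q | q
  · exact .inl ⟨p, q⟩
  · rcases h.lt_or_gt h2b h2c with r | r
    · exact absurd (q.trans (hlt.trans r)).le hcb
    · exact .inr ⟨r, q.trans hlt⟩
  · rcases h.swap.lt_or_gt h2c h2b with r | r
    · exact absurd (p.trans (hlt.trans r)).le hbc
    · exact .inr ⟨p.trans hlt, r⟩
  · exact .inr ⟨p.trans hlt, q.trans hlt⟩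

end IsOneDefectPair

theorem mainTheorem5 {S : VSignature.{u}} [Fintype S.Symbol] {D : Type v} [Fintype D]
    [PartialOrder D] (A : ValuedStructure S D) (b c : D) (g₁ g₂ : D → D → D)
    (hdefect : IsOneDefectPair b c g₁ g₂)
    (hmulti : A.IsMultimorphism g₁ g₂) :
    ValuedStructure.SolvedByBLPg.{u, v, w} A ∧
    ((g₁ b c < b ∧ g₁ b c < c) ∨ (b < g₂ b c ∧ c < g₂ b c)) ∧
    ((g₁ b c < b ∧ g₁ b c < c) → ∀ m : ℕ, 0 < m →
      ∃ h : (Fin m → D) → D, GeneratedByBinary g₁ h ∧ IsSymmetricOp h) ∧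
    ((b < g₂ b c ∧ c < g₂ b c) → ∀ m : ℕ, 0 < m →
      ∃ h : (Fin m → D) → D, GeneratedByBinary g₂ h ∧ IsSymmetricOp h) := by
  have : Nonempty D := ⟨b⟩
  refine ⟨?_, hdefect.lt_or_lt, fun h m hm => ?_, fun h m hm => ?_⟩
  · rcases hdefect.lt_or_lt with h | h
    · exact hmulti.solvedByBLPg (hdefect.le_left h.1.le h.2.le) (hdefect.le_right h.1.le h.2.le)
    -- Reversing the order does not affect the algorithm, and `g₂` becomes the operation below its
    -- arguments.
    · exact ValuedStructure.IsMultimorphism.solvedByBLPg (D := Dᵒᵈ) hmulti.swap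
        (hdefect.dual.le_left h.1.le h.2.le) (hdefect.dual.le_right h.1.le h.2.le)
  · exact exists_isSymmetricOp_of_le (hdefect.le_left h.1.le h.2.le)
      (hdefect.le_right h.1.le h.2.le) hm
  · exact exists_isSymmetricOp_of_le (D := Dᵒᵈ) (hdefect.dual.le_left h.1.le h.2.le)
      (hdefect.dual.le_right h.1.le h.2.le) hm
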